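/- Write $\mathbb N=\{1,2,3,\dots\}$ and $\varrho_2(x)=\max(0,x)^2$ (ReQU). A network $\Phi=((A_1,b_1),\dots,(A_L,b_L))$ with $L=L(\Phi)\ge 1$ layers, $A_j\in\mathbb R^{N_j\times N_{j-1}}$, $b_j\in\mathbb R^{N_j}$, $N_j\in\mathbb N$, has realization $R\Phi=T_L\circ(\varrho_2\circ T_{L-1})\circ\dots\circ(\varrho_2\circ T_1)$, where $T_jx=A_jx+b_j$ and $\varrho_2$ acts componentwise; $W(\Phi)$ is the number of non-zero entries of all $A_j,b_j$, and $\|\Phi\|$ is the largest absolute value of these entries. Let $\ell:\mathbb N\to\mathbb N_{\ge5}\cup\{\infty\}$ and $c:\mathbb N\to\mathbb N\cup\{\infty\}$ be non-decreasing, $d\in\mathbb N$, $\alpha\in(0,\infty)$. Let $$\Sigma_n=\{R\Phi:\ N_0=d,\ N_L=1,\ W(\Phi)\le n,\ L(\Phi)\le\ell(n),\ \|\Phi\|\le c(n)\},$$ $$\Gamma(u)=\max\Big\{\|u\|_{L^\infty([0,1]^d)},\ \sup_{n\in\mathbb N} n^\alpha\inf_{g\in\Sigma_n}\|u-g\|_{L^\infty([0,1]^d)}\Big\},\qquad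 \|u\|_A=\inf\{\theta>0:\Gamma(u/\theta)\le1\},$$ and let $U=\{u:\|u\|_A\le1\}$, regarded as a subset of $C([0,1]^d)$, with embedding $\iota_\infty:U\to C([0,1]^d)$. Put $\ell^*=\sup_n\ell(n)$ and $$\gamma^\flat(\ell,c)=\sup\Big\{\gamma\ge0:\ \exists L\in\mathbb N,\ L\le\ell^*,\ \exists C>0\ \forall n\in\mathbb N:\ n^\gamma\le C\,c(n)^{2^L-1}\,n^{(2^L-1)/2}\Big\}\in[0,\infty].$$ For $m\in\mathbb N$ let $\mathrm{Alg}_m$ be the set of maps $A:U\to C([0,1]^d)$ of the form $A(u)=Q(u(x_1),\dots,u(x_m))$ with fixed $x_1,\dots,x_m\in[0,1]^d$ and an arbitrary map $Q:\mathbb R^m\to C([0,1]^d)$, and let $e_m^{\det}=\inf_{A\in\mathrm{Alg}_m}\sup_{u\in U}\|A(u)-u\|_\infty$. A Monte Carlo method using $m$ samples is a family $(A_\omega)_{\omega\in\Omega}$ of maps $U\to C([0,1]^d)$ indexed by a probability space, together with a measurable $\mathbf m:\Omega\to\mathbb N$ with $\mathbb E[\mathbf m]\le m$, such that $\omega\mapsto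 A_\omega(u)$ is Borel measurable for each $u\in U$ and $A_\omega\in\mathrm{Alg}_{\mathbf m(\omega)}$ for each $\omega$; $e_m^{\mathrm{MC}}$ is the infimum over all such methods of $\sup_{u\in U}\mathbb E_\omega\|u-A_\omega(u)\|_\infty$. For $*\in\{\det,\mathrm{MC}\}$ let $$\mathrm{err}^{*}(U,\iota_\infty)=\sup\{\beta\ge0:\ \exists C>0\ \forall m\in\mathbb N:\ e_m^{*}\le C\,m^{-\beta}\}.$$ Then $$\mathrm{err}^{\det}(U,\iota_\infty)\le\frac{64\,\alpha}{d\,(8\alpha+\gamma^\flat(\ell,c))}\qquad\text{and}\qquad \mathrm{err}^{\mathrm{MC}}(U,\iota_\infty)\le\frac{64\,\alpha}{d\,(8\alpha+\gamma^\flat(\ell,c))},$$ where the right-hand side is $0$ if $\gamma^\flat(\ell,c)=\infty$. -/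

import Mathlib

open MeasureTheory
open scoped ENNReal NNReal Matrix

universe u v w

noncomputable section

namespace ReQU

/-- The rectified quadratic unit `x ↦ max(0, x)²`. -/
def requ (x : ℝ) : ℝ := (max 0 x) ^ 2

/-- The number of non-zero entries of a matrix. -/
def matrixL0 {m n : ℕ} (A : Matrix (Fin m) (Fin n) ℝ) : ℕ :=
  (Finset.univ.filter fun p : Fin m × Fin n => A p.1 p.2 ≠ 0).card

/-- The number of non-zero entries of a vector. -/
def vecL0 {m : ℕ} (b : Fin m → ℝ) : ℕ :=
  (Finset.univ.filter fun i : Fin m => b i ≠ 0).card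

/-- The largest absolute value of an entry of a matrix. -/
def matrixSup {m n : ℕ} (A : Matrix (Fin m) (Fin n) ℝ) : ℝ≥0 :=
  Finset.univ.sup fun p : Fin m × Fin n => ‖A p.1 p.2‖₊

/-- The largest absolute value of an entry of a vector. -/
def vecSup {m : ℕ} (b : Fin m → ℝ) : ℝ≥0 :=
  Finset.univ.sup fun i : Fin m => ‖b i‖₊

/-- A neural network `((A₁, b₁), …, (A_L, b_L))`, `L ≥ 1`, with given input and output dimension,
as a list of layers: `last A b` is the network with the single layer `(A, b)`, and `cons A b Φ` is
the network with first layer `(A, b)`, followed by the layers of `Φ`. The hidden layers have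
positive width. -/
inductive Network : ℕ → ℕ → Type
  | last {din dout : ℕ} (A : Matrix (Fin dout) (Fin din) ℝ) (b : Fin dout → ℝ) : Network din dout
  | cons {din k dout : ℕ} (hk : 0 < k) (A : Matrix (Fin k) (Fin din) ℝ) (b : Fin k → ℝ)
      (Φ : Network k dout) : Network din dout

namespace Network

/-- The number of layers `L(Φ)`. -/
def layers : {din dout : ℕ} → Network din dout → ℕ
  | _, _, last _ _ => 1
  | _, _, cons _ _ _ Φ => Φ.layers + 1

/-- The number of non-zero weights `W(Φ)`. -/
def weights : {din dout : ℕ} → Network din dout → ℕ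
  | _, _, last A b => matrixL0 A + vecL0 b
  | _, _, cons _ A b Φ => matrixL0 A + vecL0 b + Φ.weights

/-- The largest absolute value of a weight, `‖Φ‖_NN`. -/
def weightSup : {din dout : ℕ} → Network din dout → ℝ≥0
  | _, _, last A b => max (matrixSup A) (vecSup b)
  | _, _, cons _ A b Φ => max (max (matrixSup A) (vecSup b)) Φ.weightSup

/-- The realization `T_L ∘ (ϱ₂ ∘ T_{L-1}) ∘ ⋯ ∘ (ϱ₂ ∘ T_1)`, where `T_j x = A_j x + b_j` and the
activation function `ϱ₂` acts componentwise. -/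
def realize : {din dout : ℕ} → Network din dout → (Fin din → ℝ) → (Fin dout → ℝ)
  | _, _, last A b => fun x => A *ᵥ x + b
  | _, _, cons _ A b Φ => fun x => Φ.realize (fun i => requ ((A *ᵥ x + b) i))

end Network

/-! Throughout, `ℕ+` is the set `{1, 2, 3, …}` and `ℕ∞` is `ℕ ∪ {∞}`. -/

/-- The family `Σ_n` of realizations of networks with input dimension `d`, output dimension `1`,
at most `n` non-zero weights of magnitude at most `c n`, and at most `ell n` layers. -/
def networkClass (ell c : ℕ+ → ℕ∞) (d : ℕ) (n : ℕ+) : Set ((Fin d → ℝ) → ℝ) :=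
  {g | ∃ Φ : Network d 1, Φ.weights ≤ (n : ℕ) ∧ (Φ.layers : ℕ∞) ≤ ell n ∧
    (Φ.weightSup : ℝ≥0∞) ≤ (c n : ℝ≥0∞) ∧ g = fun x => Φ.realize x 0}

/-- The supremum `ℓ*` of the depth-growth function. -/
def maxDepth (ell : ℕ+ → ℕ∞) : ℕ∞ := ⨆ n, ell n

/-- The exponent `γ♭(ell, c) ∈ [0, ∞]`: the supremum of all real `γ ≥ 0` for which there are a
positive integer `L ≤ ℓ*` and `C > 0` with `n ^ γ ≤ C * c n ^ (2 ^ L - 1) * n ^ ((2 ^ L - 1) / 2)`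
for all `n`. -/
def gammaFlat (ell c : ℕ+ → ℕ∞) : ℝ≥0∞ :=
  ⨆ (γ : ℝ≥0) (_ : ∃ L : ℕ+, ((L : ℕ) : ℕ∞) ≤ maxDepth ell ∧ ∃ C : ℝ≥0, 0 < C ∧ ∀ n : ℕ+,
    ((n : ℕ) : ℝ≥0∞) ^ (γ : ℝ) ≤
      (C : ℝ≥0∞) * (c n : ℝ≥0∞) ^ (2 ^ (L : ℕ) - 1 : ℕ)
        * ((n : ℕ) : ℝ≥0∞) ^ (((2 : ℝ) ^ (L : ℕ) - 1) / 2)), (γ : ℝ≥0∞)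

/-- Lebesgue measure on a subset of `ℝ^d`. -/
def lebesgueOn {d : ℕ} (Ω : Set (Fin d → ℝ)) : Measure Ω :=
  (volume : Measure (Fin d → ℝ)).comap Subtype.val

/-- The distance in `L^p(Ω)`, with respect to Lebesgue measure, of `u` to a set of functions. -/
def lpDist {d : ℕ} (p : ℝ≥0∞) {Ω : Set (Fin d → ℝ)} (u : Ω → ℝ)
    (G : Set ((Fin d → ℝ) → ℝ)) : ℝ≥0∞ :=
  ⨅ g ∈ G, eLpNorm (fun x : Ω => u x - g x) p (lebesgueOn Ω)

/-- The functional `Γ_{α,p}(u) = max {‖u‖_{L^p(Ω)}, sup_n n^α d_p(u, Σ_n)}`. -/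
def approxGamma (ell c : ℕ+ → ℕ∞) {d : ℕ} (α : ℝ) (p : ℝ≥0∞) {Ω : Set (Fin d → ℝ)}
    (u : Ω → ℝ) : ℝ≥0∞ :=
  max (eLpNorm u p (lebesgueOn Ω))
    (⨆ n : ℕ+, ((n : ℕ) : ℝ≥0∞) ^ α * lpDist p u (networkClass ell c d n))

/-- The quasi-norm `‖u‖ = inf {θ > 0 : Γ_{α,p}(u / θ) ≤ 1} ∈ [0, ∞]`. -/
def approxNorm (ell c : ℕ+ → ℕ∞) {d : ℕ} (α : ℝ) (p : ℝ≥0∞) {Ω : Set (Fin d → ℝ)}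
    (u : Ω → ℝ) : ℝ≥0∞ :=
  ⨅ (θ : ℝ≥0) (_ : 0 < θ ∧ approxGamma ell c α p (fun x => u x / (θ : ℝ)) ≤ 1), (θ : ℝ≥0∞)

/-- The approximation space: the functions in `L^p(Ω)` of finite quasi-norm. -/
def approxSpace (ell c : ℕ+ → ℕ∞) {d : ℕ} (α : ℝ) (p : ℝ≥0∞) (Ω : Set (Fin d → ℝ)) :
    Set (Ω → ℝ) :=
  {u | MemLp u p (lebesgueOn Ω) ∧ approxNorm ell c α p u < ∞}

/-- The cube `[0,1]^d`. -/
abbrev Cube (d : ℕ) : Set (Fin d → ℝ) := Set.Icc 0 1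

/-- The unit ball of the approximation space with `p = ∞` on `[0,1]^d`. Its elements are
represented by continuous functions, on which point evaluations make sense. -/
def unitBall (ell c : ℕ+ → ℕ∞) (d : ℕ) (α : ℝ) : Set C(Cube d, ℝ) :=
  {u | (⇑u : Cube d → ℝ) ∈ approxSpace ell c α ∞ (Cube d) ∧
    approxNorm ell c α ∞ (⇑u : Cube d → ℝ) ≤ 1}

/-- The embedding of the unit ball into `C([0,1]^d)`. -/
def iotaInfty (ell c : ℕ+ → ℕ∞) (d : ℕ) (α : ℝ) : unitBall ell c d α → C(Cube d, ℝ) :=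
  fun u => u.1

section Algorithms

variable {d : ℕ} {Y : Type v} [NormedAddCommGroup Y]

/-- `A ∈ Alg_m(U, Y)`: the map `A : U → Y` only uses the values of its argument at `m` fixed
points of `[0,1]^d`. -/
def IsDetAlg (U : Set C(Cube d, ℝ)) (m : ℕ) (A : U → Y) : Prop :=
  ∃ (x : Fin m → Cube d) (Q : (Fin m → ℝ) → Y), ∀ u : U, A u = Q (fun i => u.1 (x i))

/-- The optimal deterministic error with `m` point samples. -/
def detError (U : Set C(Cube d, ℝ)) (S : U → Y) (m : ℕ+) : ℝ≥0∞ :=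
  ⨅ (A : U → Y) (_ : IsDetAlg U m A), ⨆ u : U, ‖A u - S u‖ₑ

/-- The optimal order of a sequence of errors `e`: the supremum in `[0, ∞]` of all real `β ≥ 0`
such that `e m ≤ C * m ^ (-β)` for all `m`, with some constant `C > 0`. -/
def optimalOrder (e : ℕ+ → ℝ≥0∞) : ℝ≥0∞ :=
  ⨆ (β : ℝ≥0) (_ : ∃ C : ℝ≥0, 0 < C ∧ ∀ m : ℕ+,
    e m ≤ (C : ℝ≥0∞) * ((m : ℕ) : ℝ≥0∞) ^ (-(β : ℝ))), (β : ℝ≥0∞)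

/-- The optimal order for deterministically approximating `S` using point samples. -/
def detOrder (U : Set C(Cube d, ℝ)) (S : U → Y) : ℝ≥0∞ := optimalOrder (detError U S)

/-- A Monte Carlo method using `m` point samples (in expectation): a family of deterministic
methods, indexed by a probability space, of random order `numSamples`. -/
structure MonteCarloMethod (U : Set C(Cube d, ℝ)) (Y : Type v) [NormedAddCommGroup Y]
    (m : ℕ+) where
  /-- the probability space -/
  Sample : Type w
  [mSample : MeasurableSpace Sample]
  /-- its probability measure -/
  P : Measure Sample
  [isProb : IsProbabilityMeasure P]
  /-- the family of maps -/
  alg : Sample → U → Y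
  /-- the random number of point samples -/
  numSamples : Sample → ℕ+
  measurable_numSamples : Measurable fun ω => (numSamples ω : ℕ)
  expectation_le : ∫⁻ ω, ((numSamples ω : ℕ) : ℝ≥0∞) ∂P ≤ ((m : ℕ) : ℝ≥0∞)
  measurable_alg : ∀ u : U, Measurable[mSample, borel Y] fun ω => alg ω u
  isDetAlg : ∀ ω, IsDetAlg U (numSamples ω) (alg ω)

/-- The expected error of a Monte Carlo method at `u`. -/
def MonteCarloMethod.expectedError {U : Set C(Cube d, ℝ)} {m : ℕ+}
    (M : MonteCarloMethod U Y m) (S : U → Y) (u : U) : ℝ≥0∞ :=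
  @lintegral M.Sample M.mSample M.P fun ω => ‖S u - M.alg ω u‖ₑ

end Algorithms

/-- The optimal Monte Carlo error with `m` point samples. The probability spaces live in an
arbitrary universe `w`. -/
def mcError {d : ℕ} {Y : Type v} [NormedAddCommGroup Y] (U : Set C(Cube d, ℝ)) (S : U → Y)
    (m : ℕ+) : ℝ≥0∞ :=
  ⨅ M : MonteCarloMethod.{v, w} U Y m, ⨆ u : U, M.expectedError S u

/-- The optimal Monte Carlo order for approximating `S` using point samples. -/
def mcOrder {d : ℕ} {Y : Type v} [NormedAddCommGroup Y] (U : Set C(Cube d, ℝ)) (S : U → Y) :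
    ℝ≥0∞ :=
  optimalOrder (mcError.{v, w} U S)

end ReQU

end

namespace ReQU

/-! ### Networks -/

/-! The unit ball contains many tall bumps with disjoint supports, and `m` point samples cannot
distinguish most of them from `0`.

Bumps: since `requ t + requ (-t) = t ^ 2`, three layers compute `(1 + g) ^ 2` and `1`, where `g =
requ (δ ^ 2 - |x - a| ^ 2)` has height `δ ^ 4`. Two chains of layers with `k` equal neurons of
weight `c` then square these repeatedly. The difference of their outputs is `K * ((1 + g) ^ 2 ^ (r +
1) - 1) ≥ K * g`, with `K = (c * k) ^ (2 ^ (r + 1) - 1)`. The shift by `1` is essential: powers of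
`g` itself would shrink with `δ`, whereas here the gain stays at least linear in `g`. The cost is
`O(k ^ 2)` weights (`exists_bump`), and height `N ^ (-α)` with `N = D * k ^ 2` puts the bump in the
unit ball (`mem_unitBall`).

Sampling: for `m` samples and `4 * m` or more bumps, averaging over the bumps gives error at least
`N ^ (-α) / 8`, even for random methods (`le_mcError`).

Rate: an exponent `γ` admissible for `gammaFlat` gives `K ≳ k ^ (γ / 8)`. One may thus use `M ^ d`
bumps of radius `1 / (2 * M)` with `M ≈ k ^ τ`, `τ = (8 * α + γ) / 32`. Errors of order `β` would
force `k ^ (-2 * α) ≲ k ^ (-τ * d * β)` as `k → ∞`, so `τ * d * β ≤ 2 * α`. Deterministic methods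
are a special case. -/

theorem requ_of_nonneg {x : ℝ} (hx : 0 ≤ x) : requ x = x ^ 2 := by
  simp [requ, max_eq_right hx]

theorem requ_of_nonpos {x : ℝ} (hx : x ≤ 0) : requ x = 0 := by
  simp [requ, max_eq_left hx]

theorem requ_nonneg (x : ℝ) : 0 ≤ requ x := sq_nonneg _

/-- This identity lets one hidden layer produce the squares whose sum is the squared Euclidean
distance to the centre of a bump. -/
theorem requ_add_requ_neg (x : ℝ) : requ x + requ (-x) = x ^ 2 := by
  rcases le_total 0 x with h | h
  · rw [requ_of_nonneg h, requ_of_nonpos (neg_nonpos.2 h), add_zero]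
  · rw [requ_of_nonpos h, requ_of_nonneg (neg_nonneg.2 h), zero_add, neg_sq]

theorem continuous_requ : Continuous requ := by
  unfold requ
  fun_prop

theorem Network.continuous_realize {m n : ℕ} (Φ : Network m n) : Continuous Φ.realize := by
  induction Φ with
  | last A b =>
    simp only [Network.realize]
    exact (Continuous.matrix_mulVec continuous_const continuous_id).add continuous_const
  | cons hk A b Φ ih =>
    simp only [Network.realize]
    refine ih.comp (continuous_pi fun i => continuous_requ.comp ?_)
    exact (continuous_apply i).comp
      ((Continuous.matrix_mulVec continuous_const continuous_id).add continuous_const)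

theorem matrixL0_le {m n : ℕ} (A : Matrix (Fin m) (Fin n) ℝ) : matrixL0 A ≤ m * n :=
  (Finset.card_filter_le _ _).trans (by simp)

theorem vecL0_le {m : ℕ} (b : Fin m → ℝ) : vecL0 b ≤ m :=
  (Finset.card_filter_le _ _).trans (by simp)

theorem matrixSup_le {m n : ℕ} {A : Matrix (Fin m) (Fin n) ℝ} {c : ℝ≥0}
    (h : ∀ i j, |A i j| ≤ c) : matrixSup A ≤ c :=
  Finset.sup_le fun p _ => by
    rw [← NNReal.coe_le_coe, coe_nnnorm, Real.norm_eq_abs]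
    exact h _ _

theorem vecSup_le {m : ℕ} {b : Fin m → ℝ} {c : ℝ≥0} (h : ∀ i, |b i| ≤ c) : vecSup b ≤ c :=
  Finset.sup_le fun i _ => by
    rw [← NNReal.coe_le_coe, coe_nnnorm, Real.norm_eq_abs]
    exact h _

/-! ### Amplifying networks and bump networks -/

/-- The vector with `k` entries `y`, followed by `k` entries `z`. -/
def twoBlock (k : ℕ) (y z : ℝ) : Fin (k + k) → ℝ := fun i => if (i : ℕ) < k then y else z

theorem sum_twoBlock (k : ℕ) (y z : ℝ) : ∑ i, twoBlock k y z i = k * y + k * z := by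
  simp [twoBlock, Fin.sum_univ_add]

/-- The network with `r` hidden layers consisting of two parallel chains of layers of `k` equal
neurons with weights `c`, whose outputs are subtracted and scaled by `s`. -/
def ampNet {k : ℕ} (hk : 0 < k) (c s : ℝ) : ℕ → Network (k + k) 1
  | 0 => .last (fun _ => twoBlock k (s * c) (-(s * c))) 0
  | r + 1 => .cons (by omega)
      (fun i => if (i : ℕ) < k then twoBlock k c 0 else twoBlock k 0 c) 0 (ampNet hk c s r)

/-- Each hidden layer maps the block values `y, z` to `(c * k * y) ^ 2` and `(c * k * z) ^ 2`; the
last layer contributes one more factor `c * k` and the subtraction. The exponents of `c * k` add up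
to `1 + 2 + ⋯ + 2 ^ r`. -/
theorem ampNet_realize {k : ℕ} (hk : 0 < k) {c : ℝ} (hc : 0 ≤ c) (s : ℝ) (r : ℕ) :
    ∀ {y z : ℝ}, 0 ≤ y → 0 ≤ z → (ampNet hk c s r).realize (twoBlock k y z) 0 =
      s * ((c * k) ^ (2 ^ (r + 1) - 1) * (y ^ 2 ^ r - z ^ 2 ^ r)) := by
  induction r with
  | zero =>
    intro y z _ _
    have h : ∀ i, twoBlock k (s * c) (-(s * c)) i * twoBlock k y z i =
        twoBlock k (s * c * y) (-(s * c) * z) i := by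
      intro i
      unfold twoBlock
      split_ifs <;> rfl
    simp only [ampNet, Network.realize, Matrix.mulVec, dotProduct, Pi.add_apply, Pi.zero_apply, h,
      sum_twoBlock]
    norm_num
    ring
  | succ r ih =>
    intro y z hy hz
    have h1 : ∀ i, twoBlock k c 0 i * twoBlock k y z i = twoBlock k (c * y) 0 i := by
      intro i
      unfold twoBlock
      split_ifs <;> simp
    have h2 : ∀ i, twoBlock k 0 c i * twoBlock k y z i = twoBlock k 0 (c * z) i := by
      intro i
      unfold twoBlock
      split_ifs <;> simp
    have hstep : (ampNet hk c s (r + 1)).realize (twoBlock k y z) =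
        (ampNet hk c s r).realize (twoBlock k ((c * k * y) ^ 2) ((c * k * z) ^ 2)) := by
      simp only [ampNet, Network.realize]
      congr 1
      funext i
      by_cases hi : (i : ℕ) < k
      · simp only [Matrix.mulVec, dotProduct, Pi.add_apply, Pi.zero_apply, hi, if_true, h1,
          sum_twoBlock]
        rw [requ_of_nonneg (by positivity)]
        simp only [twoBlock, hi, if_true]
        ring
      · simp only [Matrix.mulVec, dotProduct, Pi.add_apply, Pi.zero_apply, hi, if_false, h2,
          sum_twoBlock]
        rw [requ_of_nonneg (by positivity)]
        simp only [twoBlock, hi, if_false]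
        ring
    rw [hstep, ih (by positivity) (by positivity)]
    have e1 : (2 : ℕ) ^ (r + 1 + 1) - 1 = (2 ^ (r + 1) - 1) + 2 * 2 ^ r := by
      have : 1 ≤ 2 ^ r := Nat.one_le_two_pow
      rw [pow_succ, pow_succ]
      omega
    rw [e1, pow_add (c * (k : ℝ)), ← pow_mul, ← pow_mul, pow_succ' 2 r]
    generalize 2 * 2 ^ r = q
    ring

theorem ampNet_layers {k : ℕ} (hk : 0 < k) (c s : ℝ) (r : ℕ) :
    (ampNet hk c s r).layers = r + 1 := by
  induction r with
  | zero => rfl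
  | succ r ih => simp [ampNet, Network.layers, ih]

theorem ampNet_weights {k : ℕ} (hk : 0 < k) (c s : ℝ) (r : ℕ) :
    (ampNet hk c s r).weights ≤ (6 * r + 3) * k ^ 2 := by
  have hk2 : k ≤ k ^ 2 := Nat.le_self_pow two_ne_zero k
  induction r with
  | zero =>
    refine (add_le_add (matrixL0_le _) (vecL0_le _)).trans ?_
    nlinarith
  | succ r ih =>
    refine (add_le_add (add_le_add (matrixL0_le _) (vecL0_le _)) ih).trans ?_
    nlinarith

theorem abs_twoBlock_le {k : ℕ} {y z c : ℝ} (hy : |y| ≤ c) (hz : |z| ≤ c) (i : Fin (k + k)) :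
    |twoBlock k y z i| ≤ c := by
  unfold twoBlock
  split_ifs <;> assumption

theorem ampNet_weightSup {k : ℕ} (hk : 0 < k) (c : ℝ≥0) {s : ℝ} (hs : |s| ≤ 1) (r : ℕ) :
    (ampNet hk c s r).weightSup ≤ c := by
  have hsc : |s * c| ≤ c := by
    rw [abs_mul, NNReal.abs_eq]
    exact mul_le_of_le_one_left c.2 hs
  induction r with
  | zero =>
    refine max_le (matrixSup_le fun i j => abs_twoBlock_le hsc ?_ j) (vecSup_le fun i => by simp)
    rwa [abs_neg]
  | succ r ih =>
    refine max_le (max_le (matrixSup_le fun i j => ?_) (vecSup_le fun i => by simp)) ih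
    split_ifs
    · exact abs_twoBlock_le (by simp) (by simp) j
    · exact abs_twoBlock_le (by simp) (by simp) j

/-- A network whose realization is a bump at `a`, vanishing outside of the ball of radius `δ`. -/
def bumpNet {d k : ℕ} (hd : 0 < d) (hk : 0 < k) (c s : ℝ) (r : ℕ) (a : Fin d → ℝ) (δ : ℝ) :
    Network d 1 :=
  .cons (k := d + d) (by omega)
    (Fin.append (fun p => Pi.single p 1) (fun p => Pi.single p (-1))) (Fin.append (-a) a)
    (.cons one_pos (fun _ _ => -1) (fun _ => δ ^ 2)
      (.cons (k := k + k) (by omega) (fun i _ => twoBlock k 1 0 i) (fun _ => 1)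
        (ampNet hk c s r)))

/-- The three layers in front compute the one-sided squares of `±(x - a)`, then the small bump `g`,
then the blocks `(1 + g) ^ 2` and `1` that enter the amplifier. Outside the support of `g` the two
chains cancel exactly. -/
theorem bumpNet_realize {d k : ℕ} (hd : 0 < d) (hk : 0 < k) {c : ℝ} (hc : 0 ≤ c) (s : ℝ) (r : ℕ)
    (a : Fin d → ℝ) (δ : ℝ) (x : Fin d → ℝ) :
    (bumpNet hd hk c s r a δ).realize x 0 = s * ((c * k) ^ (2 ^ (r + 1) - 1) *
      ((1 + requ (δ ^ 2 - ∑ i, (x i - a i) ^ 2)) ^ 2 ^ (r + 1) - 1)) := by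
  have h1 : ∑ j, requ ((Matrix.mulVec (Fin.append (fun p => Pi.single p 1)
      (fun p => Pi.single p (-1)) : Matrix (Fin (d + d)) (Fin d) ℝ) x + Fin.append (-a) a) j) =
      ∑ i, (x i - a i) ^ 2 := by
    rw [Fin.sum_univ_add, ← Finset.sum_add_distrib]
    refine Finset.sum_congr rfl fun p _ => ?_
    rw [← requ_add_requ_neg]
    congr 2
    · simp [Matrix.mulVec, Fin.append_left, sub_eq_add_neg]
    · simp only [Pi.add_apply, Matrix.mulVec, Fin.append_right, single_dotProduct]
      ring
  have h2 : (bumpNet hd hk c s r a δ).realize x = (ampNet hk c s r).realize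
      (twoBlock k ((1 + requ (δ ^ 2 - ∑ i, (x i - a i) ^ 2)) ^ 2) 1) := by
    have hg : 0 ≤ requ (δ ^ 2 - ∑ i, (x i - a i) ^ 2) := requ_nonneg _
    simp only [bumpNet, Network.realize]
    congr 1
    funext i
    simp only [Matrix.mulVec, dotProduct, Pi.add_apply, Finset.univ_unique, Finset.sum_singleton,
      neg_one_mul, Finset.sum_neg_distrib]
    have h1' := h1
    simp only [Matrix.mulVec, dotProduct, Pi.add_apply] at h1'
    rw [h1', neg_add_eq_sub]
    by_cases hi : (i : ℕ) < k
    · simp only [twoBlock, hi, if_true, one_mul]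
      rw [requ_of_nonneg (by positivity), add_comm]
    · simp only [twoBlock, hi, if_false, zero_mul, zero_add]
      rw [requ_of_nonneg zero_le_one, one_pow]
  rw [h2, ampNet_realize hk hc s r (by positivity) zero_le_one, one_pow, ← pow_mul, ← pow_succ']

theorem bumpNet_layers {d k : ℕ} (hd : 0 < d) (hk : 0 < k) (c s : ℝ) (r : ℕ) (a : Fin d → ℝ)
    (δ : ℝ) : (bumpNet hd hk c s r a δ).layers = r + 4 := by
  simp [bumpNet, Network.layers, ampNet_layers]

theorem bumpNet_weights {d k : ℕ} (hd : 0 < d) (hk : 0 < k) (c s : ℝ) (r : ℕ) (a : Fin d → ℝ)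
    (δ : ℝ) : (bumpNet hd hk c s r a δ).weights ≤ (2 * d ^ 2 + 4 * d + 6 * r + 8) * k ^ 2 := by
  have hk2 : k ≤ k ^ 2 := Nat.le_self_pow two_ne_zero k
  refine (add_le_add (add_le_add (matrixL0_le _) (vecL0_le _))
    (add_le_add (add_le_add (matrixL0_le _) (vecL0_le _))
      (add_le_add (add_le_add (matrixL0_le _) (vecL0_le _)) (ampNet_weights hk c s r)))).trans ?_
  have h1 : 1 ≤ k ^ 2 := Nat.one_le_pow _ _ hk
  have h3 : 2 * d ^ 2 + 4 * d + 1 ≤ (2 * d ^ 2 + 4 * d + 1) * k ^ 2 := Nat.le_mul_of_pos_right _ h1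
  nlinarith

theorem bumpNet_weightSup {d k : ℕ} (hd : 0 < d) (hk : 0 < k) {c : ℝ≥0} (hc : 1 ≤ c) {s : ℝ}
    (hs : |s| ≤ 1) (r : ℕ) {a : Fin d → ℝ} (ha : ∀ i, |a i| ≤ 1) {δ : ℝ} (hδ : |δ| ≤ 1) :
    (bumpNet hd hk c s r a δ).weightSup ≤ c := by
  have hc' : (1 : ℝ) ≤ c := by exact_mod_cast hc
  refine max_le (max_le (matrixSup_le fun i j => ?_) (vecSup_le fun i => ?_))
    (max_le (max_le (matrixSup_le fun i j => ?_) (vecSup_le fun i => ?_))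
      (max_le (max_le (matrixSup_le fun i j => ?_) (vecSup_le fun i => ?_))
        (ampNet_weightSup hk c hs r)))
  · refine le_trans ?_ hc'
    refine Fin.addCases (fun p => ?_) (fun p => ?_) i
    · rw [Fin.append_left, Pi.single_apply]
      split_ifs <;> simp
    · rw [Fin.append_right, Pi.single_apply]
      split_ifs <;> simp
  · refine le_trans ?_ hc'
    refine Fin.addCases (fun p => ?_) (fun p => ?_) i
    · rw [Fin.append_left, Pi.neg_apply, abs_neg]
      exact ha p
    · rw [Fin.append_right]
      exact ha p
  · simpa using hc'
  · rw [abs_pow]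
    exact (pow_le_one₀ (abs_nonneg _) hδ).trans hc'
  · exact (abs_twoBlock_le (by simp) (by simp) i).trans hc'
  · simpa using hc'

/-- Bumps of height `h` supported in balls of radius `δ` are realized by networks of depth `r + 4`
if `h ≤ (c * k) ^ (2 ^ (r + 1) - 1) * δ ^ 4`. -/
theorem exists_bump {d k : ℕ} (hd : 0 < d) (hk : 0 < k) {c : ℝ≥0} (hc : 1 ≤ c) (r : ℕ)
    {a : Fin d → ℝ} (ha : ∀ i, |a i| ≤ 1) {δ : ℝ} (hδ0 : 0 < δ) (hδ : δ ≤ 1) {h : ℝ} (h0 : 0 ≤ h)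
    (hh : h ≤ ((c : ℝ) * k) ^ (2 ^ (r + 1) - 1) * δ ^ 4) :
    ∃ Φ : Network d 1, Φ.layers = r + 4 ∧
      Φ.weights ≤ (2 * d ^ 2 + 4 * d + 6 * r + 8) * k ^ 2 ∧ Φ.weightSup ≤ c ∧
      Φ.realize a 0 = h ∧ (∀ x, |Φ.realize x 0| ≤ h) ∧
      ∀ x i, δ ≤ |x i - a i| → Φ.realize x 0 = 0 := by
  have hc0 : (0 : ℝ) < c := lt_of_lt_of_le one_pos (by exact_mod_cast hc)
  have hk0 : (0 : ℝ) < k := by exact_mod_cast hk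
  set K : ℝ := ((c : ℝ) * k) ^ (2 ^ (r + 1) - 1) with hK
  have hK0 : 0 < K := by positivity
  set H : ℝ := K * ((1 + δ ^ 4) ^ 2 ^ (r + 1) - 1) with hH
  have hδ4 : 0 < δ ^ 4 := by positivity
  -- This makes the unscaled peak `H` at least `K * δ ^ 4 ≥ h`, so the factor `h / H` that corrects
  -- the height is at most `1` and does not enlarge the weights.
  have hb : 1 + δ ^ 4 ≤ (1 + δ ^ 4) ^ 2 ^ (r + 1) :=
    le_self_pow₀ (by linarith) (by positivity)
  have hhH : h ≤ H := hh.trans (mul_le_mul_of_nonneg_left (by linarith) hK0.le)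
  have hH0 : 0 < H := mul_pos hK0 (by linarith)
  have hs0 : 0 ≤ h / H := by positivity
  have hs1 : h / H ≤ 1 := (div_le_one hH0).2 hhH
  refine ⟨bumpNet hd hk c (h / H) r a δ, bumpNet_layers .., bumpNet_weights ..,
    bumpNet_weightSup hd hk hc (by rwa [abs_of_nonneg hs0]) r ha (by rwa [abs_of_pos hδ0]),
    ?_, fun x => ?_, fun x i hi => ?_⟩
  · rw [bumpNet_realize hd hk hc0.le]
    simp only [sub_self, ne_eq, OfNat.ofNat_ne_zero, not_false_eq_true, zero_pow,
      Finset.sum_const_zero, sub_zero]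
    rw [requ_of_nonneg (by positivity), ← pow_mul, ← hK]
    change h / H * H = h
    exact div_mul_cancel₀ _ hH0.ne'
  · rw [bumpNet_realize hd hk hc0.le, ← hK]
    set g := requ (δ ^ 2 - ∑ i, (x i - a i) ^ 2) with hg
    have hg0 : 0 ≤ g := requ_nonneg _
    have hS : 0 ≤ ∑ i, (x i - a i) ^ 2 := Finset.sum_nonneg fun i _ => sq_nonneg _
    have hg1 : g ≤ δ ^ 4 := by
      have : max 0 (δ ^ 2 - ∑ i, (x i - a i) ^ 2) ≤ δ ^ 2 :=
        max_le (by positivity) (by linarith)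
      calc g ≤ (δ ^ 2) ^ 2 := pow_le_pow_left₀ (le_max_left _ _) this 2
        _ = δ ^ 4 := by ring
    have h1 : 1 ≤ (1 + g) ^ 2 ^ (r + 1) := one_le_pow₀ (by linarith)
    have h2 : (1 + g) ^ 2 ^ (r + 1) ≤ (1 + δ ^ 4) ^ 2 ^ (r + 1) :=
      pow_le_pow_left₀ (by linarith) (by linarith) _
    rw [abs_of_nonneg (mul_nonneg hs0 (mul_nonneg hK0.le (by linarith)))]
    calc h / H * (K * ((1 + g) ^ 2 ^ (r + 1) - 1)) ≤ h / H * H := by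
          refine mul_le_mul_of_nonneg_left (mul_le_mul_of_nonneg_left (by linarith) hK0.le) hs0
      _ = h := div_mul_cancel₀ _ hH0.ne'
  · have hS : δ ^ 2 ≤ ∑ j, (x j - a j) ^ 2 := by
      calc δ ^ 2 ≤ |x i - a i| ^ 2 := pow_le_pow_left₀ hδ0.le hi 2
        _ = (x i - a i) ^ 2 := sq_abs _
        _ ≤ ∑ j, (x j - a j) ^ 2 :=
          Finset.single_le_sum (f := fun j => (x j - a j) ^ 2) (fun j _ => sq_nonneg _)
            (Finset.mem_univ i)
    rw [bumpNet_realize hd hk hc0.le, requ_of_nonpos (by linarith)]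
    simp

/-! ### The unit ball -/

theorem networkClass_mono {ell c : ℕ+ → ℕ∞} (hell : Monotone ell) (hc : Monotone c) (d : ℕ)
    {n m : ℕ+} (h : n ≤ m) : networkClass ell c d n ⊆ networkClass ell c d m := by
  rintro g ⟨Φ, h1, h2, h3, rfl⟩
  exact ⟨Φ, h1.trans (by exact_mod_cast h), h2.trans (hell h),
    h3.trans (ENat.toENNReal_le.2 (hc h)), rfl⟩

theorem zero_mem_networkClass {ell c : ℕ+ → ℕ∞} (hell5 : ∀ n, 5 ≤ ell n) (d : ℕ) (n : ℕ+) :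
    (fun _ => 0) ∈ networkClass ell c d n := by
  refine ⟨.last 0 0, ?_, ?_, ?_, ?_⟩
  · simp [Network.weights, matrixL0, vecL0]
  · refine le_trans ?_ (hell5 n)
    simp [Network.layers]
  · have : (Network.last (0 : Matrix (Fin 1) (Fin d) ℝ) 0).weightSup = 0 :=
      le_antisymm (max_le (matrixSup_le fun i j => by simp) (vecSup_le fun i => by simp)) bot_le
    rw [this]
    simp
  · funext x
    simp [Network.realize]

/-- Realizations of networks with `N` weights of size at most `N ^ (-α)` are in the unit ball. -/
theorem mem_unitBall {ell c : ℕ+ → ℕ∞} (hell : Monotone ell) (hell5 : ∀ n, 5 ≤ ell n)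
    (hc : Monotone c) {d : ℕ} {α : ℝ} (hα : 0 < α) {u : C(Cube d, ℝ)} {N : ℕ+}
    {g : (Fin d → ℝ) → ℝ} (hg : g ∈ networkClass ell c d N) (hu : ∀ x : Cube d, u x = g x)
    (hN : ∀ x, |u x| ≤ ((N : ℕ) : ℝ) ^ (-α)) : u ∈ unitBall ell c d α := by
  have hN1 : (1 : ℝ) ≤ ((N : ℕ) : ℝ) := by exact_mod_cast N.pos
  have hb : eLpNorm (⇑u) ∞ (lebesgueOn (Cube d)) ≤ ENNReal.ofReal (((N : ℕ) : ℝ) ^ (-α)) := by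
    rw [eLpNorm_exponent_top]
    exact eLpNormEssSup_le_of_ae_bound (Filter.Eventually.of_forall fun x => hN x)
  have hle1 : ENNReal.ofReal (((N : ℕ) : ℝ) ^ (-α)) ≤ 1 := by
    rw [← ENNReal.ofReal_one]
    exact ENNReal.ofReal_le_ofReal (Real.rpow_le_one_of_one_le_of_nonpos hN1 (by linarith))
  have hmem : MemLp (⇑u) ∞ (lebesgueOn (Cube d)) :=
    ⟨u.continuous.aestronglyMeasurable, hb.trans_lt (hle1.trans_lt ENNReal.one_lt_top)⟩
  have hGamma : approxGamma ell c α ∞ (⇑u) ≤ 1 := by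
    refine max_le (hb.trans hle1) (iSup_le fun n => ?_)
    -- For `n ≥ N` the function is itself in the class; for `n < N` approximation by `0` suffices,
    -- because `n ^ α * N ^ (-α) ≤ 1`.
    rcases le_or_gt N n with h | h
    · have : lpDist ∞ (⇑u) (networkClass ell c d n) = 0 := by
        refine le_antisymm ((iInf₂_le g (networkClass_mono hell hc d h hg)).trans ?_) bot_le
        simp only [hu, sub_self]
        exact eLpNorm_zero'.le
      rw [this, mul_zero]
      exact zero_le_one
    · have h1 : lpDist ∞ (⇑u) (networkClass ell c d n) ≤
          ENNReal.ofReal (((N : ℕ) : ℝ) ^ (-α)) := by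
        refine (iInf₂_le _ (zero_mem_networkClass hell5 d n)).trans ?_
        simpa using hb
      have hn : ((n : ℕ) : ℝ≥0∞) ^ α ≤ ENNReal.ofReal (((N : ℕ) : ℝ) ^ α) := by
        rw [← ENNReal.ofReal_rpow_of_nonneg (by positivity) hα.le, ENNReal.ofReal_natCast]
        exact ENNReal.rpow_le_rpow (by exact_mod_cast h.le) hα.le
      refine (mul_le_mul' hn h1).trans ?_
      rw [← ENNReal.ofReal_mul (by positivity), ← Real.rpow_add (by linarith)]
      simp
  have hnorm : approxNorm ell c α ∞ (⇑u) ≤ 1 := by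
    refine (iInf₂_le (1 : ℝ≥0) ⟨one_pos, ?_⟩).trans (by simp)
    simpa using hGamma
  exact ⟨⟨hmem, hnorm.trans_lt ENNReal.one_lt_top⟩, hnorm⟩

/-! ### Lower bounds for Monte Carlo methods -/

section MonteCarlo

variable {d : ℕ} {Y : Type v} [NormedAddCommGroup Y]

theorem optimalOrder_anti {e e' : ℕ+ → ℝ≥0∞} (h : ∀ m, e m ≤ e' m) :
    optimalOrder e' ≤ optimalOrder e := by
  refine iSup₂_le fun β hβ => ?_
  obtain ⟨C, hC, hC'⟩ := hβ
  exact le_iSup₂_of_le β ⟨C, hC, fun m => (h m).trans (hC' m)⟩ le_rfl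

/-- A deterministic method is a Monte Carlo method. -/
noncomputable def MonteCarloMethod.ofDet {U : Set C(Cube d, ℝ)} {m : ℕ+} {A : U → Y} (hA : IsDetAlg U m A) :
    MonteCarloMethod.{v, w} U Y m where
  Sample := PUnit
  P := Measure.dirac PUnit.unit
  alg := fun _ => A
  numSamples := fun _ => m
  measurable_numSamples := measurable_const
  expectation_le := by simp
  measurable_alg := fun _ => @measurable_const _ _ (borel Y) _ _
  isDetAlg := fun _ => hA

theorem mcError_le_detError (U : Set C(Cube d, ℝ)) (S : U → Y) (m : ℕ+) :
    mcError.{v, w} U S m ≤ detError U S m := by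
  refine le_iInf₂ fun A hA => (iInf_le _ (MonteCarloMethod.ofDet.{v, w} hA)).trans ?_
  refine iSup_mono fun u => ?_
  change ∫⁻ _ : PUnit, ‖S u - A u‖ₑ ∂Measure.dirac PUnit.unit ≤ _
  rw [lintegral_const, measure_univ, mul_one, enorm_sub_rev]

theorem detOrder_le_mcOrder (U : Set C(Cube d, ℝ)) (S : U → Y) :
    detOrder U S ≤ mcOrder.{v, w} U S :=
  optimalOrder_anti fun m => mcError_le_detError U S m

/-- By disjointness each sample point meets at most one support, so at least half of the `f i`
vanish at all sample points. The method returns the same output for these as for `0`, and the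
triangle inequality bounds `‖f i‖ₑ` by the two errors. -/
theorem IsDetAlg.le_sum {U : Set C(Cube d, ℝ)} (h0 : (0 : C(Cube d, ℝ)) ∈ U) {ι : Type*}
    [Fintype ι] {f : ι → C(Cube d, ℝ)} (hf : ∀ i, f i ∈ U)
    (hdisj : ∀ x i j, f i x ≠ 0 → f j x ≠ 0 → i = j) {h : ℝ≥0∞} (hh : ∀ i, h ≤ ‖f i‖ₑ) {m : ℕ}
    {A : U → C(Cube d, ℝ)} (hA : IsDetAlg U m A) (hm : 2 * m ≤ Fintype.card ι) :
    (Fintype.card ι : ℝ≥0∞) * h ≤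
      2 * ∑ i, (‖f i - A ⟨f i, hf i⟩‖ₑ + ‖0 - A ⟨0, h0⟩‖ₑ) := by
  classical
  obtain ⟨x, Q, hQ⟩ := hA
  set J : Finset ι := Finset.univ.filter fun i => ∃ t, f i (x t) ≠ 0 with hJ
  have hJcard : J.card ≤ m := by
    have hex : ∀ i : J, ∃ t, f i (x t) ≠ 0 := fun i => (Finset.mem_filter.1 i.2).2
    choose t ht using hex
    have hinj : Function.Injective t := fun i j hij =>
      Subtype.ext (hdisj (x (t i)) i j (ht i) (by rw [hij]; exact ht j))
    simpa using Fintype.card_le_of_injective t hinj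
  have hJc : Fintype.card ι ≤ 2 * Jᶜ.card := by
    rw [Finset.card_compl]
    omega
  have hterm : ∀ i ∈ Jᶜ, h ≤ ‖f i - A ⟨f i, hf i⟩‖ₑ + ‖0 - A ⟨0, h0⟩‖ₑ := by
    intro i hi
    have hz : ∀ t, f i (x t) = 0 := by
      simpa [hJ] using hi
    have hEq : A ⟨f i, hf i⟩ = A ⟨0, h0⟩ := by
      rw [hQ, hQ]
      simp [hz]
    refine (hh i).trans ?_
    rw [hEq]
    calc ‖f i‖ₑ = ‖(f i - A ⟨0, h0⟩) - (0 - A ⟨0, h0⟩)‖ₑ := by congr 1; abel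
      _ ≤ _ := enorm_sub_le
  calc (Fintype.card ι : ℝ≥0∞) * h ≤ ((2 * Jᶜ.card : ℕ) : ℝ≥0∞) * h := by gcongr
    _ = 2 * ∑ i ∈ Jᶜ, h := by
      rw [Finset.sum_const, nsmul_eq_mul]
      push_cast
      ring
    _ ≤ 2 * ∑ i ∈ Jᶜ, (‖f i - A ⟨f i, hf i⟩‖ₑ + ‖0 - A ⟨0, h0⟩‖ₑ) := by
      gcongr with i hi
      exact hterm i hi
    _ ≤ _ := by
      gcongr
      exact Finset.subset_univ _

/-- A set that contains `0` and at least `4 * m` functions of norm at least `h` with disjoint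
supports cannot be approximated from `m` samples up to an error less than `h / 8`. -/
theorem le_mcError {U : Set C(Cube d, ℝ)} (h0 : (0 : C(Cube d, ℝ)) ∈ U) {ι : Type*}
    [Fintype ι] {f : ι → C(Cube d, ℝ)} (hf : ∀ i, f i ∈ U)
    (hdisj : ∀ x i j, f i x ≠ 0 → f j x ≠ 0 → i = j) {h : ℝ≥0∞} (hh : ∀ i, h ≤ ‖f i‖ₑ) {m : ℕ+}
    (hm : 4 * (m : ℕ) ≤ Fintype.card ι) :
    h ≤ 8 * mcError.{0, w} U (fun u : U => (u : C(Cube d, ℝ))) m := by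
  rw [mcError, ENNReal.mul_iInf_of_ne (by norm_num) (by norm_num)]
  refine le_iInf fun M => ?_
  let _ := M.mSample
  have _ := M.isProb
  let _ : MeasurableSpace C(Cube d, ℝ) := borel _
  have _ : BorelSpace C(Cube d, ℝ) := ⟨rfl⟩
  set e := ⨆ u : U, M.expectedError (fun u : U => (u : C(Cube d, ℝ))) u with he
  have hmeas : ∀ u : U, Measurable fun ω => ‖(u : C(Cube d, ℝ)) - M.alg ω u‖ₑ := fun u =>
    (continuous_const.sub continuous_id).enorm.measurable.comp (M.measurable_alg u)
  have hle : ∀ u : U, ∫⁻ ω, ‖(u : C(Cube d, ℝ)) - M.alg ω u‖ₑ ∂M.P ≤ e := fun u =>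
    le_iSup (fun u : U => M.expectedError (fun u : U => (u : C(Cube d, ℝ))) u) u
  have hmp : (0 : ℝ≥0∞) < ((m : ℕ) : ℝ≥0∞) := by exact_mod_cast m.pos
  have hmt : ((m : ℕ) : ℝ≥0∞) ≠ ∞ := ENNReal.natCast_ne_top _
  have hnum : Measurable fun ω => ((M.numSamples ω : ℕ) : ℝ≥0∞) :=
    measurable_from_top.comp M.measurable_numSamples
  -- By Markov's inequality, fewer than `2 * m` samples are used with probability at least `1 / 2`.
  -- On that event `4 * m` bumps suffice for the deterministic bound.
  set G : Set M.Sample := {ω | 2 * ((m : ℕ) : ℝ≥0∞) ≤ ((M.numSamples ω : ℕ) : ℝ≥0∞)} with hG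
  have hGm : MeasurableSet G := measurableSet_le measurable_const hnum
  have hPG : M.P G ≤ 1 / 2 := by
    have h1 := (mul_meas_ge_le_lintegral hnum (2 * ((m : ℕ) : ℝ≥0∞)) (μ := M.P)).trans
      M.expectation_le
    rw [ENNReal.le_div_iff_mul_le (by simp) (by simp)]
    have h2 : ((m : ℕ) : ℝ≥0∞) * (M.P G * 2) ≤ (m : ℕ) * 1 := by
      rw [mul_one]
      refine le_trans (le_of_eq ?_) h1
      rw [hG]
      ring
    exact (ENNReal.mul_le_mul_iff_right hmp.ne' hmt).1 h2
  have hPGc : 1 ≤ 2 * M.P Gᶜ := by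
    have h1 : M.P G + M.P Gᶜ = 1 := by rw [measure_add_measure_compl hGm, measure_univ]
    have h2 : (1 : ℝ≥0∞) / 2 ≤ M.P Gᶜ := by
      have h3 : (1 : ℝ≥0∞) / 2 + 1 / 2 ≤ 1 / 2 + M.P Gᶜ := by
        rw [ENNReal.add_halves]
        exact h1.symm.trans_le (add_le_add_left hPG _)
      exact (ENNReal.add_le_add_iff_left (by simp)).1 h3
    calc (1 : ℝ≥0∞) = 2 * (1 / 2) := by
          rw [one_div, ENNReal.mul_inv_cancel (by simp) (by simp)]
      _ ≤ _ := by gcongr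
  set I : ℝ≥0∞ := (Fintype.card ι : ℝ≥0∞) with hI
  have hI0 : I ≠ 0 := by
    have := m.pos
    rw [hI, Nat.cast_ne_zero]
    omega
  have hIt : I ≠ ∞ := ENNReal.natCast_ne_top _
  -- The factor `8` is `2` for the probability of `Gᶜ`, `2` for the proportion of unseen bumps, and
  -- `2` for the errors at `f i` and at `0`.
  have key : I * h ≤ I * (8 * e) := by
    calc I * h ≤ (I * h) * (2 * M.P Gᶜ) := le_mul_of_one_le_right' hPGc
      _ = 2 * ∫⁻ _ in Gᶜ, I * h ∂M.P := by
        rw [setLIntegral_const]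
        ring
      _ ≤ 2 * ∫⁻ ω in Gᶜ, 2 * ∑ i, (‖f i - M.alg ω ⟨f i, hf i⟩‖ₑ +
            ‖0 - M.alg ω ⟨0, h0⟩‖ₑ) ∂M.P := by
        gcongr 2 * ?_
        refine setLIntegral_mono' hGm.compl fun ω hω => ?_
        refine IsDetAlg.le_sum h0 hf hdisj hh (M.isDetAlg ω) ?_
        have h1 : ((M.numSamples ω : ℕ) : ℝ≥0∞) < 2 * ((m : ℕ) : ℝ≥0∞) := not_le.1 hω
        have h2 : (M.numSamples ω : ℕ) < 2 * (m : ℕ) := by exact_mod_cast h1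
        omega
      _ ≤ 2 * ∫⁻ ω, 2 * ∑ i, (‖f i - M.alg ω ⟨f i, hf i⟩‖ₑ +
            ‖0 - M.alg ω ⟨0, h0⟩‖ₑ) ∂M.P := by
        gcongr
        exact Measure.restrict_le_self
      _ = 2 * (2 * ∑ i, (∫⁻ ω, ‖f i - M.alg ω ⟨f i, hf i⟩‖ₑ ∂M.P +
            ∫⁻ ω, ‖0 - M.alg ω ⟨0, h0⟩‖ₑ ∂M.P)) := by
        rw [lintegral_const_mul' _ _ (by simp), lintegral_finsetSum]
        · congr 3
          funext i
          exact lintegral_add_left (hmeas ⟨f i, hf i⟩) _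
        · exact fun i _ => (hmeas ⟨f i, hf i⟩).add (hmeas ⟨0, h0⟩)
      _ ≤ 2 * (2 * ∑ i : ι, (e + e)) := by
        gcongr with i
        · exact hle ⟨f i, hf i⟩
        · exact hle ⟨0, h0⟩
      _ = I * (8 * e) := by
        rw [Finset.sum_const, nsmul_eq_mul, Finset.card_univ, hI]
        ring
  exact (ENNReal.mul_le_mul_iff_right hI0 hIt).1 key

end MonteCarlo

/-! ### Families of bumps -/

/-- The cube is cut into `M ^ d` cells of side `1 / M`, with one bump at the midpoint of each; the
radius `1 / (2 * M)` keeps every bump inside its cell. -/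
theorem exists_bump_family {ell c : ℕ+ → ℕ∞} (hell : Monotone ell) (hell5 : ∀ n, 5 ≤ ell n)
    (hc : Monotone c) {d : ℕ} (hd : 0 < d) {α : ℝ} (hα : 0 < α) {k : ℕ} (hk : 0 < k) {N : ℕ+}
    {b : ℝ≥0} (hb : 1 ≤ b) (hbc : (b : ℝ≥0∞) ≤ c N) {r : ℕ} (hr : ((r + 4 : ℕ) : ℕ∞) ≤ ell N)
    (hN : (2 * d ^ 2 + 4 * d + 6 * r + 8) * k ^ 2 ≤ (N : ℕ)) {M : ℕ} (hM : 0 < M)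
    (hh : ((N : ℕ) : ℝ) ^ (-α) ≤ ((b : ℝ) * k) ^ (2 ^ (r + 1) - 1) * (1 / (2 * M : ℝ)) ^ 4) :
    ∃ f : (Fin d → Fin M) → C(Cube d, ℝ), (∀ i, f i ∈ unitBall ell c d α) ∧
      (∀ x i j, f i x ≠ 0 → f j x ≠ 0 → i = j) ∧
      ∀ i, ENNReal.ofReal (((N : ℕ) : ℝ) ^ (-α)) ≤ ‖f i‖ₑ := by
  have hM0 : (0 : ℝ) < M := by exact_mod_cast hM
  have hM1 : (1 : ℝ) ≤ M := by exact_mod_cast hM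
  set δ : ℝ := 1 / (2 * M : ℝ) with hδ
  have hδ0 : 0 < δ := by positivity
  have hδ1 : δ ≤ 1 := (div_le_one (by positivity)).2 (by linarith)
  set a : (Fin d → Fin M) → Fin d → ℝ := fun i p => (2 * (i p : ℕ) + 1) * δ with ha
  have hMδ : 2 * M * δ = 1 := by rw [hδ]; field_simp
  have ha0 : ∀ i p, 0 ≤ a i p := fun i p => by positivity
  have ha1 : ∀ i p, a i p ≤ 1 := fun i p => by
    have : ((i p : ℕ) : ℝ) + 1 ≤ M := by exact_mod_cast (i p).2
    rw [← hMδ]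
    exact mul_le_mul_of_nonneg_right (by linarith) hδ0.le
  have key := fun i => exists_bump hd hk hb r (a := a i)
    (fun p => abs_le.2 ⟨by linarith [ha0 i p], ha1 i p⟩) hδ0 hδ1
    (Real.rpow_nonneg (Nat.cast_nonneg (N : ℕ)) (-α)) hh
  choose Φ hΦl hΦw hΦs hΦa hΦb hΦ0 using key
  let f : (Fin d → Fin M) → C(Cube d, ℝ) := fun i =>
    ⟨fun x => (Φ i).realize x 0, (continuous_apply (0 : Fin 1)).comp
      ((Φ i).continuous_realize.comp continuous_subtype_val)⟩
  refine ⟨f, fun i => ?_, fun x i j hi hj => ?_, fun i => ?_⟩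
  · refine mem_unitBall hell hell5 hc hα (N := N) (g := fun x => (Φ i).realize x 0)
      ⟨Φ i, (hΦw i).trans hN, ?_, ?_, rfl⟩ (fun _ => rfl) fun x => hΦb i x
    · rw [hΦl]
      exact hr
    · exact (ENNReal.coe_le_coe.2 (hΦs i)).trans hbc
  · funext p
    have h1 : |x.1 p - a i p| < δ := by
      by_contra h
      exact hi (hΦ0 i x p (not_lt.1 h))
    have h2 : |x.1 p - a j p| < δ := by
      by_contra h
      exact hj (hΦ0 j x p (not_lt.1 h))
    rw [abs_lt] at h1 h2
    simp only [ha] at h1 h2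
    -- Two centres within `δ` of the same coordinate are less than `2 * δ` apart, so their indices
    -- differ by less than `1`.
    have h3 : ((i p : ℕ) : ℝ) < (j p : ℕ) + 1 := by
      refine lt_of_mul_lt_mul_right (a := δ) ?_ hδ0.le
      linarith
    have h4 : ((j p : ℕ) : ℝ) < (i p : ℕ) + 1 := by
      refine lt_of_mul_lt_mul_right (a := δ) ?_ hδ0.le
      linarith
    norm_cast at h3 h4
    exact Fin.ext (by omega)
  · have h1 : f i ⟨a i, ha0 i, ha1 i⟩ = ((N : ℕ) : ℝ) ^ (-α) := hΦa i
    have h2 := (f i).norm_coe_le_norm ⟨a i, ha0 i, ha1 i⟩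
    rw [h1, Real.norm_of_nonneg (by positivity)] at h2
    rw [← ofReal_norm]
    exact ENNReal.ofReal_le_ofReal h2

/-! ### Growth of the weights -/

/-- A finite depth not exceeding the supremum is attained, since `ℓ` takes values in `ℕ∞`. -/
theorem exists_le_of_le_maxDepth {ell : ℕ+ → ℕ∞} {L : ℕ} (h : (L : ℕ∞) ≤ maxDepth ell) :
    ∃ n, (L : ℕ∞) ≤ ell n := by
  rcases L with _ | L
  · exact ⟨1, by simp⟩
  · have h1 : (L : ℕ∞) < maxDepth ell := lt_of_lt_of_le (by exact_mod_cast L.lt_succ_self) h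
    obtain ⟨n, hn⟩ := lt_iSup_iff.1 h1
    exact ⟨n, by simpa using Order.add_one_le_of_lt hn⟩

/-- If `n ^ γ ≤ C * c ^ e * n ^ (e / 2)` with `n = k ^ 2` and `c ∈ [1, ∞]`, then `c` can be replaced
by a finite number. -/
theorem exists_finite_weight {c : ℕ∞} (hc1 : 1 ≤ c) {γ : ℝ} (hγ : 0 ≤ γ) {e : ℕ} (he : 1 ≤ e)
    {C : ℝ≥0} {k : ℕ} (hk : 0 < k)
    (h : ((k ^ 2 : ℕ) : ℝ≥0∞) ^ γ ≤
      (C : ℝ≥0∞) * (c : ℝ≥0∞) ^ e * ((k ^ 2 : ℕ) : ℝ≥0∞) ^ ((e : ℝ) / 2)) :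
    ∃ b : ℝ≥0, 1 ≤ b ∧ (b : ℝ≥0∞) ≤ c ∧
      ((k : ℝ) ^ 2) ^ γ ≤ max (C : ℝ) 1 * ((b : ℝ) * k) ^ e := by
  have hk1 : (1 : ℝ≥0) ≤ k := by exact_mod_cast hk
  have hk1' : (1 : ℝ) ≤ k := by exact_mod_cast hk
  have hk2 : (1 : ℝ≥0) ≤ (k : ℝ≥0) ^ 2 := one_le_pow₀ hk1
  induction c using ENat.recTopCoe with
  | top =>
    -- For an infinite bound the weight `(k ^ 2) ^ γ` alone gives the growth, as `e ≥ 1` and all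
    -- factors are at least `1`.
    have hb : (1 : ℝ≥0) ≤ ((k : ℝ≥0) ^ 2) ^ γ := NNReal.one_le_rpow hk2 hγ
    refine ⟨((k : ℝ≥0) ^ 2) ^ γ, hb, by simp, ?_⟩
    have hb' : (1 : ℝ) ≤ ((k : ℝ) ^ 2) ^ γ := by exact_mod_cast hb
    push_cast
    calc ((k : ℝ) ^ 2) ^ γ ≤ ((k : ℝ) ^ 2) ^ γ * k := le_mul_of_one_le_right (by linarith) hk1'
      _ ≤ (((k : ℝ) ^ 2) ^ γ * k) ^ e :=
        le_self_pow₀ (one_le_mul_of_one_le_of_one_le hb' hk1') (by omega)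
      _ ≤ _ := le_mul_of_one_le_left (by positivity) (le_max_right _ _)
  | coe c =>
    refine ⟨c, by exact_mod_cast hc1, by simp, ?_⟩
    have h1 : (((k : ℝ≥0) ^ 2) ^ γ : ℝ≥0) ≤ C * (c : ℝ≥0) ^ e * ((k : ℝ≥0) ^ 2) ^ ((e : ℝ) / 2) := by
      rw [← ENNReal.coe_le_coe]
      rw [ENNReal.coe_mul, ENNReal.coe_mul, ENNReal.coe_rpow_of_nonneg _ hγ,
        ENNReal.coe_rpow_of_nonneg _ (by positivity)]
      push_cast at h ⊢
      exact h
    have h2 : ((k : ℝ≥0) ^ 2) ^ ((e : ℝ) / 2) = (k : ℝ≥0) ^ e := by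
      rw [← NNReal.rpow_natCast, ← NNReal.rpow_mul, ← NNReal.rpow_natCast]
      congr 1
      push_cast
      ring
    rw [h2] at h1
    have h3 : ((k : ℝ) ^ 2) ^ γ ≤ C * (c : ℝ) ^ e * (k : ℝ) ^ e := by exact_mod_cast h1
    refine h3.trans ?_
    rw [mul_assoc, ← mul_pow, NNReal.coe_natCast]
    exact mul_le_mul_of_nonneg_right (le_max_left _ _) (by positivity)

/-- The lower bound for a number `m` of samples that depends on a parameter `k`. -/
theorem rate_le_mcError {ell c : ℕ+ → ℕ∞} (hell : Monotone ell) (hell5 : ∀ n, 5 ≤ ell n)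
    (hc : Monotone c) {d : ℕ} (hd : 0 < d) {α : ℝ} (hα : 0 < α) {γ : ℝ} {k : ℕ}
    (hk : 0 < k) {N n : ℕ+} {b : ℝ≥0} (hb : 1 ≤ b) (hnN : n ≤ N) (hbc : (b : ℝ≥0∞) ≤ c n) {r : ℕ}
    (hr : ((r + 4 : ℕ) : ℕ∞) ≤ ell N) (hr1 : 1 ≤ r)
    (hN : (2 * d ^ 2 + 4 * d + 6 * r + 8) * k ^ 2 ≤ (N : ℕ)) {C : ℝ} (hC : 1 ≤ C)
    (hγk : ((k : ℝ) ^ 2) ^ γ ≤ C * ((b : ℝ) * k) ^ (2 ^ (r + 4) - 1))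
    (hCk : 16 * C ≤ (k : ℝ) ^ α) {M : ℕ} (hM0 : 0 < M) (hM : (M : ℝ) ≤ (k : ℝ) ^ (α / 4 + γ / 32))
    {m : ℕ+} (hm : 4 * (m : ℕ) ≤ M ^ d) :
    ENNReal.ofReal (((N : ℕ) : ℝ) ^ (-α)) ≤
      8 * mcError.{0, w} (unitBall ell c d α) (iotaInfty ell c d α) m := by
  have hk0 : (0 : ℝ) < k := by exact_mod_cast hk
  have hk1 : (1 : ℝ) ≤ k := by exact_mod_cast hk
  have hb1 : (1 : ℝ) ≤ b := by exact_mod_cast hb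
  have hbk : 1 ≤ (b : ℝ) * k := one_le_mul_of_one_le_of_one_le hb1 hk1
  have hMp : (0 : ℝ) < M := by exact_mod_cast hM0
  set K : ℝ := ((b : ℝ) * k) ^ (2 ^ (r + 1) - 1) with hK
  have hK0 : 0 < K := by positivity
  -- Four of the `r + 4` layers give no amplification exponent beyond `2 ^ (r + 1) - 1`; the loss is
  -- at most a factor `16` in the exponent, and it turns `(k ^ 2) ^ γ` into `k ^ (γ / 8)`.
  have hKpow : ((b : ℝ) * k) ^ (2 ^ (r + 4) - 1) ≤ K ^ 16 := by
    rw [hK, ← pow_mul]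
    refine pow_le_pow_right₀ hbk ?_
    have : 2 ≤ 2 ^ r := by
      calc 2 = 2 ^ 1 := rfl
        _ ≤ 2 ^ r := Nat.pow_le_pow_right two_pos hr1
    rw [pow_add, pow_add]
    omega
  have hKγ : (k : ℝ) ^ (γ / 8) ≤ C * K := by
    have h1 : ((k : ℝ) ^ (γ / 8)) ^ 16 ≤ (C * K) ^ 16 := by
      calc ((k : ℝ) ^ (γ / 8)) ^ 16 = ((k : ℝ) ^ 2) ^ γ := by
            rw [← Real.rpow_natCast, ← Real.rpow_natCast, ← Real.rpow_mul hk0.le,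
              ← Real.rpow_mul hk0.le]
            congr 1
            push_cast
            ring
        _ ≤ C * K ^ 16 := hγk.trans (mul_le_mul_of_nonneg_left hKpow (by linarith))
        _ ≤ C ^ 16 * K ^ 16 :=
          mul_le_mul_of_nonneg_right (le_self_pow₀ hC (by norm_num)) (by positivity)
        _ = (C * K) ^ 16 := (mul_pow _ _ _).symm
    exact le_of_pow_le_pow_left₀ (by norm_num) (by positivity) h1
  have hM4 : (M : ℝ) ^ 4 ≤ (k : ℝ) ^ α * (k : ℝ) ^ (γ / 8) := by
    calc (M : ℝ) ^ 4 ≤ ((k : ℝ) ^ (α / 4 + γ / 32)) ^ 4 := pow_le_pow_left₀ hMp.le hM 4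
      _ = (k : ℝ) ^ α * (k : ℝ) ^ (γ / 8) := by
        rw [← Real.rpow_add hk0, ← Real.rpow_natCast, ← Real.rpow_mul hk0.le]
        congr 1
        push_cast
        ring
  have hkN : (k : ℝ) ^ 2 ≤ ((N : ℕ) : ℝ) := by
    have : k ^ 2 ≤ (N : ℕ) := le_trans (Nat.le_mul_of_pos_left _ (by positivity)) hN
    exact_mod_cast this
  -- Of the available `k ^ (2 * α)`, the choice of `M` uses only one factor `k ^ α`; the other
  -- absorbs the constant `16 * C`.
  have hheight : ((N : ℕ) : ℝ) ^ (-α) ≤ K * (1 / (2 * M : ℝ)) ^ 4 := by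
    have h1 : ((N : ℕ) : ℝ) ^ (-α) ≤ 1 / ((k : ℝ) ^ α * (k : ℝ) ^ α) := by
      calc ((N : ℕ) : ℝ) ^ (-α) ≤ ((k : ℝ) ^ 2) ^ (-α) :=
            Real.rpow_le_rpow_of_nonpos (by positivity) hkN (by linarith)
        _ = 1 / ((k : ℝ) ^ α * (k : ℝ) ^ α) := by
          rw [Real.rpow_neg (by positivity), sq, Real.mul_rpow hk0.le hk0.le, one_div]
    refine h1.trans ?_
    have e1 : K * (1 / (2 * M : ℝ)) ^ 4 = K / (16 * (M : ℝ) ^ 4) := by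
      field_simp
      norm_num
    have hP : 0 < (k : ℝ) ^ α := by positivity
    rw [e1, div_le_div_iff₀ (by positivity) (by positivity), one_mul]
    calc 16 * (M : ℝ) ^ 4 ≤ 16 * ((k : ℝ) ^ α * (C * K)) := by
          refine mul_le_mul_of_nonneg_left (hM4.trans ?_) (by norm_num)
          exact mul_le_mul_of_nonneg_left hKγ hP.le
      _ = (16 * C) * (K * (k : ℝ) ^ α) := by ring
      _ ≤ (k : ℝ) ^ α * (K * (k : ℝ) ^ α) := mul_le_mul_of_nonneg_right hCk (by positivity)
      _ = _ := by ring
  obtain ⟨f, hf, hdisj, hfn⟩ := exists_bump_family hell hell5 hc hd hα hk hb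
    (hbc.trans (ENat.toENNReal_le.2 (hc hnN))) hr hN hM0 hheight
  refine le_mcError ?_ hf hdisj hfn (by simpa using hm)
  exact mem_unitBall hell hell5 hc hα (N := 1) (zero_mem_networkClass hell5 d 1) (fun _ => rfl)
    fun x => by simp

/-! ### The upper bound for the order -/

/-- Monte Carlo errors of order `β` restrict the exponents `γ` in the definition of `gammaFlat`. -/
theorem mul_le_of_mcError_le {ell c : ℕ+ → ℕ∞} (hell : Monotone ell) (hell5 : ∀ n, 5 ≤ ell n)
    (hc : Monotone c) (hc1 : ∀ n, 1 ≤ c n) {d : ℕ} (hd : 0 < d) {α : ℝ} (hα : 0 < α) {γ : ℝ}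
    (hγ : 0 ≤ γ) {r : ℕ} (hr1 : 1 ≤ r) (hr : ((r + 4 : ℕ) : ℕ∞) ≤ maxDepth ell) {C : ℝ≥0}
    (hC : ∀ n : ℕ+, ((n : ℕ) : ℝ≥0∞) ^ γ ≤ (C : ℝ≥0∞) * (c n : ℝ≥0∞) ^ (2 ^ (r + 4) - 1 : ℕ)
        * ((n : ℕ) : ℝ≥0∞) ^ (((2 : ℝ) ^ (r + 4) - 1) / 2)) {β : ℝ} (hβ : 0 ≤ β) {B : ℝ≥0}
    (hB : ∀ m : ℕ+, mcError.{0, w} (unitBall ell c d α) (iotaInfty ell c d α) m ≤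
      (B : ℝ≥0∞) * ((m : ℕ) : ℝ≥0∞) ^ (-β)) :
    β * d * (8 * α + γ) ≤ 64 * α := by
  obtain ⟨n₀, hn₀⟩ := exists_le_of_le_maxDepth hr
  set τ : ℝ := α / 4 + γ / 32 with hτ
  have hτ0 : 0 < τ := by positivity
  set D : ℕ := 2 * d ^ 2 + 4 * d + 6 * r + 8 with hD
  have hD0 : (0 : ℝ) < D := by positivity
  set κ : ℝ := 1 / (8 * 2 ^ d) with hκ
  have hκ0 : 0 < κ := by positivity
  have hlim : Filter.Tendsto (fun k : ℕ => (k : ℝ)) Filter.atTop Filter.atTop :=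
    tendsto_natCast_atTop_atTop
  have hev : ∀ᶠ k : ℕ in Filter.atTop,
      (k : ℝ) ^ (τ * d * β - 2 * α) ≤ 8 * B * κ ^ (-β) * (D : ℝ) ^ α := by
    filter_upwards [Filter.eventually_ge_atTop (n₀ : ℕ), Filter.eventually_gt_atTop 0,
      (tendsto_rpow_atTop hα).comp hlim |>.eventually_ge_atTop (16 * max (C : ℝ) 1),
      (tendsto_rpow_atTop hτ0).comp hlim |>.eventually_ge_atTop 4] with k hkn hk hkα hkτ
    simp only [Function.comp_apply] at hkα hkτ
    have hk0 : (0 : ℝ) < k := by exact_mod_cast hk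
    set M : ℕ := ⌊(k : ℝ) ^ τ⌋₊ with hMdef
    have hM : (M : ℝ) ≤ (k : ℝ) ^ τ := Nat.floor_le (by positivity)
    have hM' : (k : ℝ) ^ τ < M + 1 := Nat.lt_floor_add_one _
    have hM4 : 4 ≤ M := Nat.le_floor (by exact_mod_cast hkτ)
    have hMd : 4 ≤ M ^ d := hM4.trans (Nat.le_self_pow hd.ne' M)
    let m : ℕ+ := ⟨M ^ d / 4, by omega⟩
    have hm : ((m : ℕ+) : ℕ) = M ^ d / 4 := rfl
    -- Two indices are needed: the growth condition is used at the square `n = k ^ 2`, where `n ^ (e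
    -- / 2) = k ^ e`, while the bumps need `N = D * k ^ 2` weights. Monotonicity of `c` links the
    -- two.
    let n : ℕ+ := ⟨k ^ 2, by positivity⟩
    have hn : (n : ℕ) = k ^ 2 := rfl
    let N : ℕ+ := ⟨D * k ^ 2, by positivity⟩
    have hN : (N : ℕ) = D * k ^ 2 := rfl
    have hD1 : 1 ≤ D := by omega
    have hnN : n ≤ N := by
      rw [← PNat.coe_le_coe, hn, hN]
      exact Nat.le_mul_of_pos_left _ hD1
    have hn₀n : n₀ ≤ n := by
      rw [← PNat.coe_le_coe, hn]
      exact hkn.trans (Nat.le_self_pow two_ne_zero k)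
    obtain ⟨b, hb1, hbc, hbγ⟩ := exists_finite_weight (hc1 n) hγ (e := 2 ^ (r + 4) - 1)
      (C := C) (by have := Nat.one_lt_two_pow (n := r + 4) (by omega); omega) hk (by
        have := hC n
        rw [hn] at this
        rw [Nat.cast_sub Nat.one_le_two_pow]
        exact_mod_cast this)
    have hle := (rate_le_mcError.{w} hell hell5 hc hd hα hk hb1 hnN hbc
      (hn₀.trans (hell (hn₀n.trans hnN))) hr1 hN.ge (le_max_right _ _) hbγ hkα (by omega) hM
      (m := m) (by omega)).trans (mul_le_mul' le_rfl (hB m))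
    have hmpos : (0 : ℝ) < ((m : ℕ) : ℝ) := by exact_mod_cast m.pos
    have hle' : ((N : ℕ) : ℝ) ^ (-α) ≤ 8 * (B * ((m : ℕ) : ℝ) ^ (-β)) := by
      rw [← ENNReal.ofReal_le_ofReal_iff (by positivity)]
      refine hle.trans (le_of_eq ?_)
      rw [ENNReal.ofReal_mul (by norm_num), ENNReal.ofReal_mul (by positivity),
        ← ENNReal.ofReal_rpow_of_pos hmpos, ENNReal.ofReal_natCast, ENNReal.ofReal_coe_nnreal]
      simp
    have hmκ : κ * (k : ℝ) ^ (τ * d) ≤ ((m : ℕ) : ℝ) := by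
      have h1 : (M : ℝ) ^ d ≤ 8 * ((m : ℕ) : ℝ) := by
        -- Rounding down in `m = M ^ d / 4` loses at most `3`, which is absorbed because `m ≥ 1`.
        have : M ^ d ≤ 8 * (m : ℕ) := by omega
        exact_mod_cast this
      have h2 : (k : ℝ) ^ τ ≤ 2 * M := by
        have : (4 : ℝ) ≤ M := by exact_mod_cast hM4
        linarith
      have h3 : (k : ℝ) ^ (τ * d) ≤ 2 ^ d * (8 * ((m : ℕ) : ℝ)) := by
        calc (k : ℝ) ^ (τ * d) = ((k : ℝ) ^ τ) ^ d := by
              rw [Real.rpow_mul hk0.le, Real.rpow_natCast]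
          _ ≤ (2 * M) ^ d := pow_le_pow_left₀ (by positivity) h2 d
          _ = 2 ^ d * (M : ℝ) ^ d := mul_pow _ _ _
          _ ≤ _ := mul_le_mul_of_nonneg_left h1 (by positivity)
      rw [hκ, one_div, inv_mul_le_iff₀ (by positivity)]
      linarith
    have hmβ : ((m : ℕ) : ℝ) ^ (-β) ≤ κ ^ (-β) * (k : ℝ) ^ (-(τ * d * β)) := by
      calc ((m : ℕ) : ℝ) ^ (-β) ≤ (κ * (k : ℝ) ^ (τ * d)) ^ (-β) :=
            Real.rpow_le_rpow_of_nonpos (by positivity) hmκ (by linarith)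
        _ = _ := by
          rw [Real.mul_rpow hκ0.le (by positivity), ← Real.rpow_mul hk0.le, mul_neg]
    have hNα : ((N : ℕ) : ℝ) ^ (-α) = (D : ℝ) ^ (-α) * (k : ℝ) ^ (-(2 * α)) := by
      rw [hN, Nat.cast_mul, Nat.cast_pow, Real.mul_rpow hD0.le (by positivity),
        ← Real.rpow_natCast, ← Real.rpow_mul hk0.le]
      push_cast
      rw [mul_neg]
    rw [hNα] at hle'
    have h5 : (D : ℝ) ^ (-α) * (k : ℝ) ^ (-(2 * α)) ≤
        8 * (B * (κ ^ (-β) * (k : ℝ) ^ (-(τ * d * β)))) :=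
      hle'.trans (by gcongr)
    have hDD : (D : ℝ) ^ α * (D : ℝ) ^ (-α) = 1 := by
      rw [← Real.rpow_add hD0, add_neg_cancel, Real.rpow_zero]
    have hkk : (k : ℝ) ^ (τ * d * β) * (k : ℝ) ^ (-(τ * d * β)) = 1 := by
      rw [← Real.rpow_add hk0, add_neg_cancel, Real.rpow_zero]
    calc (k : ℝ) ^ (τ * d * β - 2 * α)
        = ((D : ℝ) ^ α * (D : ℝ) ^ (-α)) * ((k : ℝ) ^ (τ * d * β) * (k : ℝ) ^ (-(2 * α))) := by
          rw [hDD, one_mul, ← Real.rpow_add hk0, sub_eq_add_neg]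
      _ = (D : ℝ) ^ α * (k : ℝ) ^ (τ * d * β) * ((D : ℝ) ^ (-α) * (k : ℝ) ^ (-(2 * α))) := by ring
      _ ≤ (D : ℝ) ^ α * (k : ℝ) ^ (τ * d * β) *
          (8 * (B * (κ ^ (-β) * (k : ℝ) ^ (-(τ * d * β))))) :=
        mul_le_mul_of_nonneg_left h5 (by positivity)
      _ = 8 * B * κ ^ (-β) * (D : ℝ) ^ α *
          ((k : ℝ) ^ (τ * d * β) * (k : ℝ) ^ (-(τ * d * β))) := by ring
      _ = _ := by rw [hkk, mul_one]
  -- A positive exponent would make the left side of `hev` unbounded as `k → ∞`.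
  have hexp : τ * d * β - 2 * α ≤ 0 := by
    by_contra! hpos
    obtain ⟨k, hk1, hk2⟩ := (hev.and ((tendsto_rpow_atTop hpos).comp hlim
      |>.eventually_gt_atTop (8 * B * κ ^ (-β) * (D : ℝ) ^ α))).exists
    exact absurd hk1 (not_le.2 hk2)
  rw [hτ] at hexp
  nlinarith

/-- The depth in the definition of `gammaFlat` may be assumed to be at least `5`. -/
theorem exists_depth_of_gammaFlat {ell c : ℕ+ → ℕ∞} (hell5 : ∀ n, 5 ≤ ell n)
    (hc1 : ∀ n, 1 ≤ c n) {γ : ℝ} {L : ℕ+} (hL : ((L : ℕ) : ℕ∞) ≤ maxDepth ell) {C : ℝ≥0}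
    (hC : ∀ n : ℕ+, ((n : ℕ) : ℝ≥0∞) ^ γ ≤ (C : ℝ≥0∞) * (c n : ℝ≥0∞) ^ (2 ^ (L : ℕ) - 1 : ℕ)
        * ((n : ℕ) : ℝ≥0∞) ^ (((2 : ℝ) ^ (L : ℕ) - 1) / 2)) :
    ∃ r : ℕ, 1 ≤ r ∧ ((r + 4 : ℕ) : ℕ∞) ≤ maxDepth ell ∧
      ∀ n : ℕ+, ((n : ℕ) : ℝ≥0∞) ^ γ ≤ (C : ℝ≥0∞) * (c n : ℝ≥0∞) ^ (2 ^ (r + 4) - 1 : ℕ)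
        * ((n : ℕ) : ℝ≥0∞) ^ (((2 : ℝ) ^ (r + 4) - 1) / 2) := by
  have h5 : ((5 : ℕ) : ℕ∞) ≤ maxDepth ell := (hell5 1).trans (le_iSup ell 1)
  have hLr : (L : ℕ) ≤ max (L : ℕ) 5 - 4 + 4 := by omega
  refine ⟨max (L : ℕ) 5 - 4, by omega, ?_, fun n => (hC n).trans ?_⟩
  · rw [Nat.sub_add_cancel (by omega)]
    rcases max_choice (L : ℕ) 5 with h | h <;> rw [h] <;> assumption
  · have hcn : (1 : ℝ≥0∞) ≤ (c n : ℝ≥0∞) := by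
      have := ENat.toENNReal_le.2 (hc1 n)
      simpa using this
    have hn : (1 : ℝ≥0∞) ≤ ((n : ℕ) : ℝ≥0∞) := by exact_mod_cast n.pos
    -- Both bases are at least `1`, so increasing the depth only weakens the condition.
    refine mul_le_mul' (mul_le_mul' le_rfl (pow_le_pow_right₀ hcn ?_))
      (ENNReal.rpow_le_rpow_of_exponent_le hn ?_)
    · exact Nat.sub_le_sub_right (Nat.pow_le_pow_right two_pos hLr) 1
    · have := pow_le_pow_right₀ (one_le_two (α := ℝ)) hLr
      linarith

theorem mcOrder_unitBall_le {ell c : ℕ+ → ℕ∞} (hell : Monotone ell) (hell5 : ∀ n, 5 ≤ ell n)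
    (hc : Monotone c) (hc1 : ∀ n, 1 ≤ c n) {d : ℕ} (hd : 0 < d) {α : ℝ} (hα : 0 < α) :
    mcOrder.{0, w} (unitBall ell c d α) (iotaInfty ell c d α) ≤
      ENNReal.ofReal (64 * α) / ((d : ℝ≥0∞) * (ENNReal.ofReal (8 * α) + gammaFlat ell c)) := by
  refine iSup₂_le fun β hβ => ?_
  obtain ⟨B, -, hB⟩ := hβ
  have hd0 : (0 : ℝ) < d := by exact_mod_cast hd
  rcases eq_or_ne β 0 with rfl | hβ0
  · simp
  have hβp : (0 : ℝ) < β := by exact_mod_cast pos_iff_ne_zero.2 hβ0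
  have hβd : 0 < (β : ℝ) * d := by positivity
  have hγ : gammaFlat ell c ≤ ENNReal.ofReal (64 * α / (β * d) - 8 * α) := by
    refine iSup₂_le fun γ hγ => ?_
    obtain ⟨L, hL, C, -, hC⟩ := hγ
    obtain ⟨r, hr1, hr, hC'⟩ := exists_depth_of_gammaFlat hell5 hc1 hL hC
    have h := mul_le_of_mcError_le.{w} hell hell5 hc hc1 hd hα γ.2 hr1 hr hC' β.2 hB
    rw [← ENNReal.ofReal_coe_nnreal]
    refine ENNReal.ofReal_le_ofReal ?_
    rw [le_sub_iff_add_le, le_div_iff₀ hβd]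
    calc ((γ : ℝ) + 8 * α) * (β * d) = β * d * (8 * α + γ) := by ring
      _ ≤ _ := h
  -- The exponent `γ = 0` is always admissible, with `L = 1` and `C = 1`. It shows that
  -- `ENNReal.ofReal` does not truncate the bound on `gammaFlat` above.
  have h0 : 0 ≤ 64 * α / (β * d) - 8 * α := by
    have hL : ((1 : ℕ+) : ℕ∞) ≤ maxDepth ell :=
      le_trans (by norm_num) ((hell5 1).trans (le_iSup ell 1))
    obtain ⟨r, hr1, hr, hC'⟩ := exists_depth_of_gammaFlat (γ := 0) (L := 1) (C := 1) hell5 hc1 hL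
      (fun n => by
        have hcn : (1 : ℝ≥0∞) ≤ (c n : ℝ≥0∞) := by
          have := ENat.toENNReal_le.2 (hc1 n)
          simpa using this
        have hn : (1 : ℝ≥0∞) ≤ ((n : ℕ) : ℝ≥0∞) := by exact_mod_cast n.pos
        rw [ENNReal.rpow_zero, ENNReal.coe_one, one_mul]
        exact one_le_mul (one_le_pow₀ hcn) (ENNReal.one_le_rpow hn (by norm_num)))
    have h := mul_le_of_mcError_le.{w} hell hell5 hc hc1 hd hα le_rfl hr1 hr hC' β.2 hB
    rw [sub_nonneg, le_div_iff₀ hβd]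
    calc 8 * α * (β * d) = β * d * (8 * α + 0) := by ring
      _ ≤ _ := h
  have hpos : (0 : ℝ≥0∞) < ENNReal.ofReal (8 * α) := ENNReal.ofReal_pos.2 (by positivity)
  have hdne : (d : ℝ≥0∞) ≠ 0 := by exact_mod_cast hd.ne'
  rw [ENNReal.le_div_iff_mul_le
    (Or.inl (mul_ne_zero hdne (ne_of_gt (lt_of_lt_of_le hpos le_self_add))))
    (Or.inl (ENNReal.mul_ne_top (by simp)
      (ENNReal.add_ne_top.2 ⟨ENNReal.ofReal_ne_top, ne_top_of_le_ne_top ENNReal.ofReal_ne_top hγ⟩)))]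
  calc (β : ℝ≥0∞) * (d * (ENNReal.ofReal (8 * α) + gammaFlat ell c))
      ≤ β * (d * (ENNReal.ofReal (8 * α) + ENNReal.ofReal (64 * α / (β * d) - 8 * α))) := by gcongr
    _ = ENNReal.ofReal (64 * α) := by
      rw [← ENNReal.ofReal_add (by positivity) h0, ← ENNReal.ofReal_natCast d,
        ← ENNReal.ofReal_coe_nnreal, ← ENNReal.ofReal_mul hd0.le, ← ENNReal.ofReal_mul hβp.le]
      congr 1
      field_simp
      ring

end ReQU

theorem mainTheorem3 (ell c : ℕ+ → ℕ∞) (hell : Monotone ell) (hell5 : ∀ n, 5 ≤ ell n)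
    (hc : Monotone c) (hc1 : ∀ n, 1 ≤ c n) (d : ℕ) (hd : 0 < d) (α : ℝ) (hα : 0 < α) :
    ReQU.detOrder (ReQU.unitBall ell c d α) (ReQU.iotaInfty ell c d α) ≤
        ENNReal.ofReal (64 * α) / ((d : ℝ≥0∞) * (ENNReal.ofReal (8 * α) + ReQU.gammaFlat ell c)) ∧
      ReQU.mcOrder.{0, u} (ReQU.unitBall ell c d α) (ReQU.iotaInfty ell c d α) ≤
        ENNReal.ofReal (64 * α) /
          ((d : ℝ≥0∞) * (ENNReal.ofReal (8 * α) + ReQU.gammaFlat ell c)) :=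
  have h := ReQU.mcOrder_unitBall_le.{u} hell hell5 hc hc1 hd hα
  ⟨(ReQU.detOrder_le_mcOrder.{0, u} _ _).trans h, h⟩
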